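/- All graphs are finite and simple. For a graph $G$ with Laplacian $L = D - A$, let $U_G(t) = \exp(-itL)$ for $t\in\mathbb{R}$, and let $e_u$ be the characteristic vector of a vertex $u$. $G$ has \emph{Laplacian perfect state transfer} between $u$ and $v$ if $U_G(\tau)e_u = \gamma e_v$ for some $\tau \in \mathbb{R}$ and $\gamma \in \mathbb{C}$, and \emph{Laplacian pretty good state transfer} between $u$ and $v$ if for every $\epsilon > 0$ there are $t \in \mathbb{R}$ and $\gamma \in \mathbb{C}$ with $\|U_G(t)e_u - \gamma e_v\| < \epsilon$ in the Euclidean norm. The \emph{eigenvalue support} of $u$ is the set of eigenvalues $\lambda$ of $L$ such that $F_\lambda e_u \neq 0$, where $F_\lambda$ is the orthogonal projection onto the $\lambda$-eigenspace of $L$. For a graph $G$ on $\{v_1,\dots,v_n\}$ and an $n$-tuple $\mathbf{H} = (H_1,\dots,H_n)$ of graphs, the \emph{corona} $G\circ\mathbf{H}$ is the disjoint union of $G, H_1, \dots, H_n$ with an additional edge from $v_j$ to each vertex of $H_j$, for each $j$; the vertex $v_j$ of $G$, viewed in $G \circ \mathbf{H}$, is written $(v_j,0)$. \textbf{Theorem.}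 Let $G$ be a graph on $n$ vertices and let $\mathbf{H} = (H_1,\dots,H_n)$ be an $n$-tuple of graphs, each on $m \geq 1$ vertices. Suppose that $G$ has Laplacian perfect state transfer between vertices $u$ and $v$, and that $2^r$ (with $r \geq 0$ an integer) is the greatest power of two dividing each element of the eigenvalue support of $u$, the elements of which are in particular integers. If $2^{r+1}$ divides $m+1$, then $G \circ \mathbf{H}$ has Laplacian pretty good state transfer between $(u,0)$ and $(v,0)$. -/

import Mathlib

namespace LaplacianWalk

noncomputable section

/-- The (inhomogeneous) corona `G ∘ H` of a graph `G` with a family `H` of graphs, one for each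
vertex of `G`. The vertex `(v, 0)` is `⟨v, none⟩`, and the vertex `(v, w)` with `w` a vertex of
`H v` is `⟨v, some w⟩`. -/
def corona {V : Type*} {W : V → Type*} (G : SimpleGraph V) (H : ∀ v, SimpleGraph (W v)) :
    SimpleGraph (Σ v, Option (W v)) where
  Adj x y :=
    (x.2 = none ∧ y.2 = none ∧ G.Adj x.1 y.1) ∨
    (∃ (v : V) (w w' : W v), x = ⟨v, some w⟩ ∧ y = ⟨v, some w'⟩ ∧ (H v).Adj w w') ∨
    (x.1 = y.1 ∧ Xor (x.2 = none) (y.2 = none))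
  symm := by
    constructor
    rintro x y (⟨hx, hy, h⟩ | ⟨v, w, w', hx, hy, h⟩ | ⟨h, h'⟩)
    · exact Or.inl ⟨hy, hx, h.symm⟩
    · exact Or.inr (Or.inl ⟨v, w', w, hy, hx, h.symm⟩)
    · exact Or.inr (Or.inr ⟨h.symm, Or.symm h'⟩)
  loopless := by
    constructor
    rintro x (⟨_, _, h⟩ | ⟨v, w, w', hx, hy, h⟩ | ⟨_, h⟩)
    · exact G.loopless.irrefl _ h
    · subst hx
      simp only [Sigma.mk.injEq, heq_eq_eq, Option.some.injEq, true_and] at hy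
      subst hy
      exact (H v).loopless.irrefl _ h
    · rcases h with ⟨h1, h2⟩ | ⟨h1, h2⟩ <;> exact h2 h1

variable {V : Type*} [Fintype V] [DecidableEq V]

open Classical in
/-- The transition matrix `U(t) = exp(-i t L)`, where `L = D - A` is the Laplacian of `G`. -/
def transition (G : SimpleGraph V) (t : ℝ) : Matrix V V ℂ :=
  NormedSpace.exp ((-(Complex.I * (t : ℂ))) • G.lapMatrix ℂ)

/-- Laplacian perfect state transfer between `u` and `v`: at some time `τ` there is a complex
number `γ` with `U(τ) e_u = γ e_v`. -/
def HasPerfectStateTransfer (G : SimpleGraph V) (u v : V) : Prop :=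
  ∃ (τ : ℝ) (γ : ℂ),
    Matrix.mulVec (transition G τ) (Pi.single u 1) = γ • (Pi.single v 1 : V → ℂ)

/-- Laplacian pretty good state transfer between `u` and `v`: for each `ε > 0` there are a time
`t` and a complex number `γ` with `‖U(t) e_u - γ e_v‖ < ε` in the Euclidean norm. -/
def HasPrettyGoodStateTransfer (G : SimpleGraph V) (u v : V) : Prop :=
  ∀ ε : ℝ, 0 < ε → ∃ (t : ℝ) (γ : ℂ),
    ‖WithLp.toLp 2
      (Matrix.mulVec (transition G t) (Pi.single u 1) - γ • (Pi.single v 1 : V → ℂ))‖ < ε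

open Classical in
/-- The eigenspace of the Laplacian of `G` for the real number `μ`. -/
def lapEigenspace (G : SimpleGraph V) (μ : ℝ) : Submodule ℝ (EuclideanSpace ℝ V) :=
  Module.End.eigenspace (Matrix.toEuclideanLin (G.lapMatrix ℝ)) μ

/-- The eigenvalue support of the vertex `v`: the set of the Laplacian eigenvalues `μ` with
`F_μ e_v ≠ 0`, where `F_μ` is the orthogonal projection onto the eigenspace of `μ`. -/
def eigenvalueSupport (G : SimpleGraph V) (v : V) : Set ℝ :=
  {μ | lapEigenspace G μ ≠ ⊥ ∧
    (lapEigenspace G μ).starProjection (EuclideanSpace.single v 1) ≠ 0}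

/-- `2 ^ r` is the greatest power of two dividing each element of `S`. Divisibility is that of
integers, so it includes that the elements of `S` are integers. -/
def IsGreatestTwoPowDvd (S : Set ℝ) (r : ℕ) : Prop :=
  IsGreatest {k : ℕ | ∀ μ ∈ S, ∃ z : ℤ, μ = (z : ℝ) ∧ (2 : ℤ) ^ k ∣ z} r

end

end LaplacianWalk

/-!
Let `Δ(μ) = √((m + 1 + μ)² - 4μ)`. Over each Laplacian eigenvalue `μ` of `G`, with eigenvector `f`,
the corona has the two eigenvalues `(m + 1 + μ ± Δ(μ)) / 2`, and their eigenvectors span the plane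
of vectors proportional to `f` on `G` and on the attached graphs. Perfect state transfer writes
`e_u = ∑ p_j` and `e_v = ∑ (-1)^{k_j} p_j` with eigenvectors `p_j` for the eigenvalues `2^r k_j`.
As `2^{r+1}` divides `m + 1`, at the times `t = -2πq / 2^r` with `q` odd the phases over `2^r k_j`
are `(-1)^{k_j} exp(± 2πi q Δ_j / 2^{r+1})`, so it is enough to bring all numbers `q Δ_j / 2^{r+1}`
close to integers with `q` odd.

By duality in the torus, this is possible unless some integer combination of the `Δ_j / 2^{r+1}` is
half of an odd integer. The number `Δ(0) / 2^{r+1} = (m + 1) / 2^{r+1}` is an integer, and for an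
integer `μ > 0` the square root `Δ(μ)` is irrational, hence of rational trace zero; so a rational
integer combination is always an integer.
-/

namespace LaplacianWalk

open MeasureTheory UnitAddTorus
open scoped Matrix

/-! ### Odd multiples of a point of the torus -/

section torus

variable {ι : Type*} [Fintype ι]

theorem mFourier_apply_add (n : ι → ℤ) (x y : UnitAddTorus ι) :
    mFourier n (x + y) = mFourier n x * mFourier n y := by
  simp [mFourier, fourier_apply, Finset.prod_mul_distrib, smul_add, AddCircle.toCircle_add]

theorem measure_ext_of_integral_mFourier {μ ν : Measure (UnitAddTorus ι)} [IsFiniteMeasure μ]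
    [IsFiniteMeasure ν] (h : ∀ n, ∫ x, mFourier n x ∂μ = ∫ x, mFourier n x ∂ν) : μ = ν := by
  let integral (ρ : Measure (UnitAddTorus ι)) [IsFiniteMeasure ρ] : C(UnitAddTorus ι, ℂ) →L[ℂ] ℂ :=
    L1.integralCLM' ℂ ∘L ContinuousMap.toLp 1 ρ ℂ
  have integral_apply (ρ : Measure (UnitAddTorus ι)) [IsFiniteMeasure ρ]
      (f : C(UnitAddTorus ι, ℂ)) : integral ρ f = ∫ x, f x ∂ρ := by
    rw [← integral_congr_ae (f.coeFn_toLp (p := 1) (𝕜 := ℂ) ρ),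
      ← L1.integral_eq_integral, L1.integral_eq' ℂ]
    rfl
  have heq : integral μ = integral ν := by
    refine ContinuousLinearMap.ext_on
      (Submodule.dense_iff_topologicalClosure_eq_top.2 span_mFourier_closure_eq_top) ?_
    rintro _ ⟨n, rfl⟩
    simpa only [integral_apply] using h n
  refine ext_of_forall_integral_eq_of_IsFiniteMeasure fun f ↦ ?_
  have := congr($heq ⟨fun x ↦ (f x : ℂ), by fun_prop⟩)
  simpa only [integral_apply, ContinuousMap.coe_mk, integral_complex_ofReal,
    Complex.ofReal_inj] using this

-- The Haar measure of `C` and its translate by `y` have the same Fourier coefficients: each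
-- character is trivial on `C`, hence at `y`, or integrates to `0` over `C`. So `C` and `y + C`
-- coincide.
theorem mem_of_forall_mFourier_eq_one {C : AddSubgroup (UnitAddTorus ι)}
    (hC : IsClosed (C : Set (UnitAddTorus ι))) {y : UnitAddTorus ι}
    (h : ∀ n, (∀ c ∈ C, mFourier n c = 1) → mFourier n y = 1) : y ∈ C := by
  have : CompactSpace C := isCompact_iff_compactSpace.1 hC.isCompact
  let μ : Measure C := Measure.addHaarMeasure ⊤
  have heq : μ.map (fun c : C ↦ (c : UnitAddTorus ι)) = μ.map (fun c : C ↦ y + c) := by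
    refine measure_ext_of_integral_mFourier fun n ↦ ?_
    rw [integral_map (by fun_prop) (by fun_prop), integral_map (by fun_prop) (by fun_prop)]
    simp_rw [mFourier_apply_add, integral_const_mul]
    by_cases htriv : ∀ c ∈ C, mFourier n c = 1
    · rw [h n htriv, one_mul]
    · push Not at htriv
      obtain ⟨c₀, hc₀, hne⟩ := htriv
      have hinv := integral_add_left_eq_self (μ := μ)
        (fun c ↦ mFourier n (c : UnitAddTorus ι)) ⟨c₀, hc₀⟩
      simp_rw [AddSubgroup.coe_add, mFourier_apply_add, integral_const_mul] at hinv
      rw [(mul_left_eq_self₀.1 hinv).resolve_left hne, mul_zero]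
  by_contra hy
  have hmeas := congr($heq (C : Set (UnitAddTorus ι)))
  rw [Measure.map_apply (by fun_prop) hC.measurableSet,
    Measure.map_apply (by fun_prop) hC.measurableSet] at hmeas
  have hself : (fun c : C ↦ (c : UnitAddTorus ι)) ⁻¹' C = Set.univ := by ext c; simp
  have hcoset : (fun c : C ↦ y + c) ⁻¹' C = ∅ := by
    ext c
    simpa [C.add_mem_cancel_right c.2] using hy
  rw [hself, hcoset, measure_empty, Measure.measure_univ_eq_zero] at hmeas
  exact NeZero.ne μ hmeas

theorem mem_topologicalClosure_zmultiples_two_nsmul {x : UnitAddTorus ι}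
    (hx : ∀ n, mFourier n x ≠ -1) :
    x ∈ (AddSubgroup.zmultiples (2 • x)).topologicalClosure := by
  refine mem_of_forall_mFourier_eq_one (AddSubgroup.isClosed_topologicalClosure _) fun n hn ↦ ?_
  have h := hn (2 • x) (AddSubgroup.le_topologicalClosure _ (AddSubgroup.mem_zmultiples _))
  rw [two_nsmul, mFourier_apply_add] at h
  exact (mul_self_eq_one_iff.1 h).resolve_right (hx n)

theorem exists_odd_zsmul_norm_lt {x : UnitAddTorus ι}
    (hx : ∀ n, mFourier n x ≠ -1) {ε : ℝ} (hε : 0 < ε) :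
    ∃ q : ℤ, Odd q ∧ ‖q • x‖ < ε := by
  obtain ⟨_, ⟨k, rfl⟩, hk⟩ := Metric.mem_closure_iff.1
    (mem_topologicalClosure_zmultiples_two_nsmul hx) ε hε
  refine ⟨1 - 2 * k, odd_one.sub_even (even_two_mul k), ?_⟩
  have hodd : (1 - 2 * k) • x = x - k • 2 • x := by module
  rwa [hodd, ← dist_eq_norm]

end torus

/-! ### Integers and quadratic surds -/

theorem normalizedTrace_eq_zero_of_sq_eq {K L : Type*} [Field K] [CharZero K] [Field L]
    [Algebra K L] [Algebra.IsIntegral K L] {x : L} {d : K} (hd : x ^ 2 = algebraMap K L d)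
    (hx : ∀ a : K, x ≠ algebraMap K L a) : Algebra.normalizedTrace K L x = 0 := by
  have hirr : Irreducible (Polynomial.X ^ 2 - Polynomial.C d) := by
    refine X_pow_sub_C_irreducible_of_prime Nat.prime_two fun b hb ↦ ?_
    rw [← hb, map_pow, sq_eq_sq_iff_eq_or_eq_neg, ← map_neg] at hd
    exact hd.elim (hx _) (hx _)
  have hmin : minpoly K x = Polynomial.X ^ 2 - Polynomial.C d :=
    (minpoly.eq_of_irreducible_of_monic hirr (by simp [hd])
      (Polynomial.monic_X_pow_sub_C d two_ne_zero)).symm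
  rw [Algebra.normalizedTrace_minpoly, hmin, Polynomial.nextCoeff,
    Polynomial.natDegree_X_pow_sub_C]
  simp

/-- The numbers allowed as coordinates of the torus point to be approximated: the integers, and the
irrational square roots of rational numbers. Their rational traces are integers, those of the square
roots being zero. -/
def IsIntOrSurd (y : ℝ) : Prop :=
  (∃ a : ℤ, y = a) ∨ Irrational y ∧ ∃ d : ℚ, y ^ 2 = d

theorem IsIntOrSurd.isIntegral {y : ℝ} (hy : IsIntOrSurd y) : IsIntegral ℚ y := by
  rcases hy with ⟨a, rfl⟩ | ⟨-, d, hd⟩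
  · exact isIntegral_algebraMap (x := (a : ℚ))
  · exact .of_pow two_pos (hd ▸ isIntegral_algebraMap (x := d))

-- The `ℚ`-algebra structure found here is `DivisionRing.toRatAlgebra`, for which instance search
-- misses `algebraicClosure.isAlgebraic`.
instance : Algebra.IsIntegral ℚ (algebraicClosure ℚ ℝ) :=
  (algebraicClosure.isAlgebraic ℚ ℝ).isIntegral

theorem IsIntOrSurd.exists_normalizedTrace_eq {y : algebraicClosure ℚ ℝ}
    (hy : IsIntOrSurd y) : ∃ a : ℤ, Algebra.normalizedTrace ℚ (algebraicClosure ℚ ℝ) y = a := by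
  rcases hy with ⟨a, ha⟩ | ⟨hirr, d, hd⟩
  · refine ⟨a, ?_⟩
    obtain rfl : y = algebraMap ℚ _ (a : ℚ) := Subtype.ext (by simp [ha])
    exact Algebra.normalizedTrace_algebraMap_apply_eq_self ℚ _ _
  · refine ⟨0, ?_⟩
    rw [Int.cast_zero]
    refine normalizedTrace_eq_zero_of_sq_eq (d := d) (Subtype.ext (by simpa using hd)) ?_
    rintro a rfl
    exact hirr ⟨a, by simp⟩

theorem exists_int_eq_of_sum_int_mul_eq {ι : Type*} [Fintype ι] {y : ι → ℝ}
    (hy : ∀ i, IsIntOrSurd (y i)) (n : ι → ℤ) {a : ℚ} (h : ∑ i, n i * y i = a) :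
    ∃ k : ℤ, a = k := by
  let z (i : ι) : algebraicClosure ℚ ℝ :=
    ⟨y i, mem_algebraicClosure_iff.2 (hy i).isIntegral.isAlgebraic⟩
  choose b hb using fun i ↦ (show IsIntOrSurd (z i) from hy i).exists_normalizedTrace_eq
  have hz : ∑ i, n i • z i = algebraMap ℚ _ a := Subtype.ext (by simpa [z] using h)
  refine ⟨∑ i, n i * b i, ?_⟩
  have htrace := congrArg (Algebra.normalizedTrace ℚ (algebraicClosure ℚ ℝ)) hz
  rw [Algebra.normalizedTrace_algebraMap_apply_eq_self, map_sum] at htrace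
  simp_rw [map_zsmul, hb, zsmul_eq_mul] at htrace
  exact_mod_cast htrace.symm

theorem mFourier_coe_ne_neg_one {ι : Type*} [Fintype ι] {y : ι → ℝ}
    (hy : ∀ i, IsIntOrSurd (y i)) (n : ι → ℤ) :
    mFourier n (fun i ↦ (y i : UnitAddCircle)) ≠ -1 := by
  intro h
  simp only [mFourier, ContinuousMap.coe_mk, fourier_coe_apply, Complex.ofReal_one, div_one,
    ← Complex.exp_sum] at h
  rw [← Complex.exp_pi_mul_I, Complex.exp_eq_exp_iff_exists_int] at h
  obtain ⟨k, hk⟩ := h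
  have hsum : ∑ i, n i * y i = ((k + 1 / 2 : ℚ) : ℝ) := by
    have hpi : (2 * Real.pi * Complex.I : ℂ) * ∑ i, (n i : ℂ) * y i =
        2 * Real.pi * Complex.I * (k + 1 / 2) := by
      rw [Finset.mul_sum]
      simp_rw [← mul_assoc]
      rw [hk]
      ring
    have := mul_left_cancel₀ Complex.two_pi_I_ne_zero hpi
    apply Complex.ofReal_injective
    push_cast
    exact this
  obtain ⟨l, hl⟩ := exists_int_eq_of_sum_int_mul_eq hy n hsum
  have : (2 * k + 1 : ℤ) = 2 * l := by
    have : (2 * k + 1 : ℚ) = 2 * l := by linear_combination 2 * hl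
    exact_mod_cast this
  omega

theorem exists_odd_norm_exp_sub_one_lt {ι : Type*} [Finite ι] {y : ι → ℝ}
    (hy : ∀ i, IsIntOrSurd (y i)) {ε : ℝ} (hε : 0 < ε) :
    ∃ q : ℤ, Odd q ∧ ∀ i, ‖Complex.exp (2 * Real.pi * Complex.I * (q * y i)) - 1‖ < ε := by
  have := Fintype.ofFinite ι
  have hcont : Continuous fun (z : UnitAddTorus ι) i ↦ fourier 1 (z i) := by fun_prop
  obtain ⟨δ, hδ, hnear⟩ := Metric.continuous_iff.1 hcont 0 ε hε
  obtain ⟨q, hq, hqδ⟩ := exists_odd_zsmul_norm_lt (mFourier_coe_ne_neg_one hy) hδ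
  refine ⟨q, hq, fun i ↦ ?_⟩
  have h := (dist_pi_lt_iff hε).1 (hnear _ (by rwa [dist_zero_right])) i
  rw [Pi.smul_apply, ← AddCircle.coe_zsmul, fourier_coe_apply, dist_eq_norm, Pi.zero_apply,
    fourier_eval_zero] at h
  simpa using h

/-! ### Eigenvectors and state transfer -/

section exp

attribute [local instance] Matrix.linftyOpNormedRing Matrix.linftyOpNormedAlgebra

theorem exp_mulVec_of_mulVec_eq {n : Type*} [Fintype n] [DecidableEq n] {M : Matrix n n ℂ}
    {w : n → ℂ} {θ : ℂ} (h : M *ᵥ w = θ • w) :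
    NormedSpace.exp M *ᵥ w = Complex.exp θ • w := by
  have hpow (k : ℕ) : M ^ k *ᵥ w = θ ^ k • w := by
    induction k with
    | zero => simp
    | succ k ih =>
      rw [pow_succ, ← Matrix.mulVec_mulVec, h, Matrix.mulVec_smul, ih, smul_smul, pow_succ']
  have hM := (NormedSpace.exp_series_hasSum_exp' (𝕂 := ℂ) M).map
    (Matrix.mulVecBilin ℂ ℂ |>.flip w) (by
      change Continuous fun A : Matrix n n ℂ ↦ A *ᵥ w
      fun_prop)
  have hθ := (NormedSpace.exp_series_hasSum_exp' (𝕂 := ℂ) θ).smul_const w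
  rw [← Complex.exp_eq_exp_ℂ] at hθ
  refine hM.unique ?_
  convert hθ using 2 with k
  simp [hpow, smul_smul]

end exp

theorem sum_orthonormalBasis_apply_smul {ι V : Type*} [Fintype ι] [Fintype V] [DecidableEq V]
    (b : OrthonormalBasis ι ℝ (EuclideanSpace ℝ V)) (x : V) :
    ∑ i, (b i x : ℂ) • (fun y ↦ (b i y : ℂ)) = Pi.single x 1 := by
  ext y
  have h := congrArg (fun w : EuclideanSpace ℝ V ↦ (w y : ℂ))
    (b.sum_repr (EuclideanSpace.single x 1))
  simpa [OrthonormalBasis.repr_apply_apply, EuclideanSpace.inner_single_right, Pi.single_apply,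
    apply_ite] using h

theorem eq_of_forall_orthonormalBasis_apply_eq {ι V : Type*} [Fintype ι] [Fintype V]
    (b : OrthonormalBasis ι ℝ (EuclideanSpace ℝ V)) {x y : V} (h : ∀ i, b i x = b i y) :
    x = y := by
  classical
  have hsingle : (Pi.single x 1 : V → ℂ) = Pi.single y 1 := by
    simp_rw [← sum_orthonormalBasis_apply_smul b, h]
  by_contra hxy
  simpa [hxy] using congrFun hsingle x

section Laplacian

variable {V : Type*} [Fintype V] [DecidableEq V] {G : SimpleGraph V} {u v : V}

open Classical in
theorem transition_mulVec_of_mulVec_eq {w : V → ℂ} {θ : ℂ} (h : G.lapMatrix ℂ *ᵥ w = θ • w)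
    (t : ℝ) : transition G t *ᵥ w = Complex.exp (-(Complex.I * t) * θ) • w :=
  exp_mulVec_of_mulVec_eq (by rw [Matrix.smul_mulVec, h, smul_smul])

open Classical in
theorem transition_transpose (G : SimpleGraph V) (t : ℝ) :
    (transition G t)ᵀ = transition G t := by
  rw [transition, ← Matrix.exp_transpose, Matrix.transpose_smul, (G.isSymm_lapMatrix ℂ).eq]

theorem lapMatrix_mulVec_ofReal (G : SimpleGraph V) [DecidableRel G.Adj] (f : V → ℝ) :
    G.lapMatrix ℂ *ᵥ (fun x ↦ (f x : ℂ)) = fun x ↦ ((G.lapMatrix ℝ *ᵥ f) x : ℂ) := by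
  ext x
  simp [SimpleGraph.lapMatrix_mulVec_apply]

theorem lapMatrix_mulVec_ofReal_of_mulVec_eq [DecidableRel G.Adj] {f : V → ℝ} {μ : ℝ}
    (hf : G.lapMatrix ℝ *ᵥ f = μ • f) :
    G.lapMatrix ℂ *ᵥ (fun x ↦ (f x : ℂ)) = (μ : ℂ) • fun x ↦ (f x : ℂ) := by
  rw [lapMatrix_mulVec_ofReal, hf]
  ext x
  simp

open Classical in
theorem HasPerfectStateTransfer.exists_exp_mul_apply_eq (hG : HasPerfectStateTransfer G u v) :
    ∃ τ : ℝ, ∀ {w : V → ℂ} {θ : ℂ}, G.lapMatrix ℂ *ᵥ w = θ • w →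
      Complex.exp (-(Complex.I * τ) * θ) * w u = w v := by
  obtain ⟨τ, γ, hτ⟩ := hG
  have hpair {w : V → ℂ} {θ : ℂ} (hw : G.lapMatrix ℂ *ᵥ w = θ • w) :
      Complex.exp (-(Complex.I * τ) * θ) * w u = γ * w v := by
    have h := congrArg (w ⬝ᵥ ·) hτ
    simp only [Matrix.dotProduct_mulVec, dotProduct_smul] at h
    rw [← Matrix.mulVec_transpose, transition_transpose, transition_mulVec_of_mulVec_eq hw] at h
    simpa using h
  -- The constant vectors are fixed by `U(τ)`.
  have hγ : γ = 1 := by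
    have h := hpair (w := fun _ ↦ 1) (θ := 0)
      (by rw [SimpleGraph.lapMatrix_mulVec_const_eq_zero, zero_smul])
    simpa using h.symm
  exact ⟨τ, fun hw ↦ by rw [hpair hw, hγ, one_mul]⟩

open Classical in
theorem mem_eigenvalueSupport_iff {μ : ℝ} :
    μ ∈ eigenvalueSupport G u ↔ ∃ f : V → ℝ, G.lapMatrix ℝ *ᵥ f = μ • f ∧ f u ≠ 0 := by
  have hmem (f : EuclideanSpace ℝ V) :
      f ∈ lapEigenspace G μ ↔ G.lapMatrix ℝ *ᵥ f.ofLp = μ • f.ofLp := by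
    rw [lapEigenspace, Module.End.mem_eigenspace_iff, ← (WithLp.ofLp_injective 2).eq_iff,
      Matrix.ofLp_toLpLin, Matrix.toLin'_apply, WithLp.ofLp_smul]
  rw [eigenvalueSupport, Set.mem_ofPred_eq, ne_eq, ne_eq,
    Submodule.starProjection_apply_eq_zero_iff, Submodule.mem_orthogonal]
  push Not
  constructor
  · rintro ⟨-, f, hf, hfu⟩
    exact ⟨f.ofLp, (hmem f).1 hf, by simpa [EuclideanSpace.inner_single_right] using hfu⟩
  · rintro ⟨f, hf, hfu⟩
    have hf' := (hmem (WithLp.toLp 2 f)).2 hf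
    refine ⟨?_, WithLp.toLp 2 f, hf', by simpa [EuclideanSpace.inner_single_right] using hfu⟩
    rintro hbot
    rw [hbot, Submodule.mem_bot] at hf'
    exact hfu (by simpa using congr($hf' u))

open Classical in
theorem nonneg_of_mem_eigenvalueSupport {μ : ℝ} (hμ : μ ∈ eigenvalueSupport G u) : 0 ≤ μ := by
  obtain ⟨f, hf, hfu⟩ := mem_eigenvalueSupport_iff.1 hμ
  have hquad := (G.posSemidef_lapMatrix ℝ).dotProduct_mulVec_nonneg f
  rw [hf, dotProduct_smul, smul_eq_mul] at hquad
  have hpos : 0 < star f ⬝ᵥ f :=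
    Matrix.dotProduct_star_self_pos_iff.2 fun h ↦ hfu (congrFun h u)
  exact nonneg_of_mul_nonneg_left hquad hpos

theorem IsGreatestTwoPowDvd.exists_nat_mul {S : Set ℝ} {r : ℕ} (hS : IsGreatestTwoPowDvd S r)
    {μ : ℝ} (hμ : μ ∈ S) (hμ₀ : 0 ≤ μ) : ∃ k : ℕ, μ = 2 ^ r * k := by
  obtain ⟨_, rfl, c, rfl⟩ := hS.1 μ hμ
  have hc : 0 ≤ c := nonneg_of_mul_nonneg_right (mod_cast hμ₀ : (0 : ℤ) ≤ 2 ^ r * c) (by positivity)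
  lift c to ℕ using hc
  exact ⟨c, by push_cast; rfl⟩

theorem IsGreatestTwoPowDvd.exists_odd {S : Set ℝ} {r : ℕ} (hS : IsGreatestTwoPowDvd S r)
    (hS₀ : ∀ μ ∈ S, 0 ≤ μ) : ∃ k : ℕ, Odd k ∧ (2 ^ r * k : ℝ) ∈ S := by
  by_contra! hcon
  refine r.lt_succ_self.not_ge (hS.2 fun μ hμ ↦ ?_)
  obtain ⟨k, rfl⟩ := hS.exists_nat_mul hμ (hS₀ μ hμ)
  obtain ⟨d, rfl⟩ := (Nat.not_odd_iff_even.1 fun hk ↦ hcon k hk hμ).two_dvd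
  exact ⟨2 ^ r * (2 * d), by push_cast; rfl, d, by rw [pow_succ]; ring⟩

theorem eq_one_or_eq_neg_one_of_mul_ofReal_eq {z : ℂ} (hz : ‖z‖ = 1) {a b : ℝ} (ha : a ≠ 0)
    (h : z * a = b) : z = 1 ∨ z = -1 := by
  obtain rfl : z = (b / a : ℝ) := by
    rw [Complex.ofReal_div]
    exact eq_div_of_mul_eq (mod_cast ha) h
  rw [Complex.norm_real, Real.norm_eq_abs] at hz
  exact_mod_cast eq_or_eq_neg_of_abs_eq hz

open Classical in
theorem IsGreatestTwoPowDvd.exists_eigenvalue_eq_nat_mul {r : ℕ}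
    (hr : IsGreatestTwoPowDvd (eigenvalueSupport G u) r) {f : V → ℝ} {μ : ℝ}
    (hf : G.lapMatrix ℝ *ᵥ f = μ • f) (hu : f u ≠ 0) : ∃ k : ℕ, μ = 2 ^ r * k :=
  have hμ := mem_eigenvalueSupport_iff.2 ⟨f, hf, hu⟩
  hr.exists_nat_mul hμ (nonneg_of_mem_eigenvalueSupport hμ)

open Classical in
theorem HasPerfectStateTransfer.exists_sign_pow_mul_apply_eq (hG : HasPerfectStateTransfer G u v)
    {r : ℕ} (hr : IsGreatestTwoPowDvd (eigenvalueSupport G u) r) :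
    ∃ s : ℝ, (s = 1 ∨ s = -1) ∧ ∀ {f : V → ℝ} {μ : ℝ}, G.lapMatrix ℝ *ᵥ f = μ • f →
      ∃ k : ℕ, (f u ≠ 0 → μ = 2 ^ r * k) ∧ s ^ k * f u = f v := by
  obtain ⟨τ, hτ⟩ := hG.exists_exp_mul_apply_eq
  let z := Complex.exp (-(Complex.I * τ) * 2 ^ r)
  have hphase {f : V → ℝ} {k : ℕ} (hf : G.lapMatrix ℝ *ᵥ f = (2 ^ r * k : ℝ) • f) :
      z ^ k * f u = f v := by
    rw [← Complex.exp_nat_mul, ← hτ (lapMatrix_mulVec_ofReal_of_mulVec_eq hf)]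
    push_cast
    ring_nf
  have hsign {f : V → ℝ} {k : ℕ} (hf : G.lapMatrix ℝ *ᵥ f = (2 ^ r * k : ℝ) • f) (hu : f u ≠ 0) :
      z ^ k = 1 ∨ z ^ k = -1 := by
    refine eq_one_or_eq_neg_one_of_mul_ofReal_eq ?_ hu (hphase hf)
    rw [norm_pow, Complex.norm_exp]
    simp [← Complex.ofReal_ofNat, ← Complex.ofReal_pow]
  obtain ⟨k₀, hk₀, hmem⟩ := hr.exists_odd fun _ ↦ nonneg_of_mem_eigenvalueSupport
  obtain ⟨f₀, hf₀, hu₀⟩ := mem_eigenvalueSupport_iff.1 hmem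
  obtain ⟨s, hs, hzs⟩ : ∃ s : ℝ, (s = 1 ∨ s = -1) ∧ z ^ k₀ = s :=
    (hsign hf₀ hu₀).elim (fun h ↦ ⟨1, by simp [h]⟩) (fun h ↦ ⟨-1, by simp [h]⟩)
  refine ⟨s, hs, fun {f μ} hf ↦ ?_⟩
  by_cases hu : f u = 0
  · refine ⟨0, fun h ↦ absurd hu h, ?_⟩
    simpa [hu, eq_comm] using hτ (lapMatrix_mulVec_ofReal_of_mulVec_eq hf)
  obtain ⟨k, rfl⟩ := hr.exists_eigenvalue_eq_nat_mul hf hu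
  -- `z ^ k = ±1` and `k₀` is odd, so `z ^ k = (z ^ k) ^ k₀ = (z ^ k₀) ^ k = s ^ k`.
  have hodd : (z ^ k) ^ k₀ = z ^ k := by
    rcases hsign hf hu with h | h <;> simp [h, hk₀.neg_one_pow]
  rw [pow_right_comm, hzs] at hodd
  refine ⟨k, fun _ ↦ rfl, ?_⟩
  have h := hphase hf
  rw [← hodd] at h
  exact_mod_cast h

open Classical in
theorem HasPerfectStateTransfer.exists_sum_eigenvectors (hG : HasPerfectStateTransfer G u v)
    (huv : u ≠ v) {r : ℕ} (hr : IsGreatestTwoPowDvd (eigenvalueSupport G u) r) :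
    ∃ (p : V → V → ℂ) (k : V → ℕ), (∀ j, G.lapMatrix ℂ *ᵥ p j = (2 ^ r * k j : ℂ) • p j) ∧
      ∑ j, p j = Pi.single u 1 ∧ ∑ j, (-1 : ℂ) ^ k j • p j = Pi.single v 1 := by
  obtain ⟨s, hs, hsv⟩ := hG.exists_sign_pow_mul_apply_eq hr
  let hL := G.isHermitian_lapMatrix ℝ
  let b := hL.eigenvectorBasis
  choose k hk hkv using fun j ↦ hsv (hL.mulVec_eigenvectorBasis j)
  obtain rfl : s = -1 := hs.resolve_left fun h ↦
    huv (eq_of_forall_orthonormalBasis_apply_eq b fun j ↦ by simpa [h] using hkv j)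
  refine ⟨fun j ↦ (b j u : ℂ) • fun x ↦ (b j x : ℂ), k, fun j ↦ ?_,
    sum_orthonormalBasis_apply_smul b u, ?_⟩
  · by_cases hu : b j u = 0
    · simp [hu]
    · have hj := lapMatrix_mulVec_ofReal_of_mulVec_eq (hL.mulVec_eigenvectorBasis j)
      rw [hk j hu] at hj
      push_cast at hj
      rw [Matrix.mulVec_smul, hj, smul_comm]
  · rw [← sum_orthonormalBasis_apply_smul b v]
    refine Finset.sum_congr rfl fun j _ ↦ ?_
    rw [smul_smul]
    congr 1
    exact_mod_cast hkv j

theorem hasPrettyGoodStateTransfer_refl (G : SimpleGraph V) (u : V) :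
    HasPrettyGoodStateTransfer G u u := fun ε hε ↦
  ⟨0, 1, by simpa [transition, -Matrix.mulVec_single] using hε⟩

open Classical in
theorem hasPrettyGoodStateTransfer_of_sum_eigenvectors {ι : Type*} [Fintype ι] {p : ι → V → ℂ}
    {θ s : ι → ℂ} (hp : ∀ i, G.lapMatrix ℂ *ᵥ p i = θ i • p i) (hu : ∑ i, p i = Pi.single u 1)
    (hv : ∑ i, s i • p i = Pi.single v 1)
    (h : ∀ δ > 0, ∃ t : ℝ, ∀ i, ‖Complex.exp (-(Complex.I * t) * θ i) - s i‖ < δ) :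
    HasPrettyGoodStateTransfer G u v := by
  intro ε hε
  have hcont : Continuous fun z : ι → ℂ ↦ WithLp.toLp 2 (∑ i, z i • p i) := by fun_prop
  obtain ⟨δ, hδ, hnear⟩ := Metric.continuous_iff.1 hcont s ε hε
  obtain ⟨t, ht⟩ := h δ hδ
  have hU : transition G t *ᵥ Pi.single u 1 =
      ∑ i, Complex.exp (-(Complex.I * t) * θ i) • p i := by
    rw [← hu, Matrix.mulVec_sum]
    exact Finset.sum_congr rfl fun i _ ↦ transition_mulVec_of_mulVec_eq (hp i) t
  refine ⟨t, 1, ?_⟩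
  rw [hU, one_smul, ← hv, WithLp.toLp_sub, ← dist_eq_norm]
  exact hnear _ ((dist_pi_lt_iff hδ).2 fun i ↦ by rw [dist_eq_norm]; exact ht i)

end Laplacian

/-! ### The Laplacian of a corona -/

section corona

theorem lapMatrix_mulVec_eq_sum_ite {X R : Type*} [Fintype X] [DecidableEq X] [CommRing R]
    (G : SimpleGraph X) [DecidableRel G.Adj] (w : X → R) (x : X) :
    (G.lapMatrix R *ᵥ w) x = ∑ y, if G.Adj x y then w x - w y else 0 := by
  rw [SimpleGraph.lapMatrix_mulVec_apply, ← Finset.sum_filter, Finset.sum_sub_distrib,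
    Finset.sum_const, nsmul_eq_mul]
  simp [SimpleGraph.neighborFinset_eq_filter, ← SimpleGraph.card_neighborFinset_eq_degree]

variable {V : Type*} {W : V → Type*} {G : SimpleGraph V} {H : ∀ v, SimpleGraph (W v)}

theorem corona_adj_none_none {a b : V} :
    (corona G H).Adj ⟨a, none⟩ ⟨b, none⟩ ↔ G.Adj a b := by
  refine ⟨?_, fun h ↦ Or.inl ⟨rfl, rfl, h⟩⟩
  rintro (⟨-, -, h⟩ | ⟨c, x, -, hx, -⟩ | ⟨-, ⟨-, h⟩ | ⟨-, h⟩⟩)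
  · exact h
  · obtain ⟨rfl, hx⟩ := Sigma.mk.inj hx
    simp at hx
  · exact absurd rfl h
  · exact absurd rfl h

theorem corona_adj_none_some {a b : V} {w : W b} :
    (corona G H).Adj ⟨a, none⟩ ⟨b, some w⟩ ↔ a = b := by
  refine ⟨?_, fun h ↦ Or.inr (Or.inr ⟨h, Or.inl ⟨rfl, Option.some_ne_none w⟩⟩)⟩
  rintro (⟨-, h, -⟩ | ⟨c, x, -, hx, -⟩ | ⟨h, -⟩)
  · simp at h
  · obtain ⟨rfl, hx⟩ := Sigma.mk.inj hx
    simp at hx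
  · exact h

theorem eq_of_corona_adj_some_some {a b : V} {w : W a} {w' : W b}
    (h : (corona G H).Adj ⟨a, some w⟩ ⟨b, some w'⟩) : a = b := by
  rcases h with ⟨h, -⟩ | ⟨c, x, x', hx, hy, -⟩ | ⟨h, -⟩
  · simp at h
  · rw [Sigma.mk.injEq] at hx hy
    exact hx.1.trans hy.1.symm
  · exact h

/-- The vector on the corona that is `g` on the base graph and takes the constant value `h a` on the
graph attached to `a`, as a linear function of `(g, h)`. Such vectors form an invariant subspace of
the Laplacian of the corona, whatever the attached graphs are. -/
def coronaLift (W : V → Type*) : (V → ℂ) × (V → ℂ) →ₗ[ℂ] (Σ v, Option (W v)) → ℂ where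
  toFun p x := x.2.elim (p.1 x.1) fun _ ↦ p.2 x.1
  map_add' p q := by ext ⟨a, _ | _⟩ <;> simp
  map_smul' c p := by ext ⟨a, _ | _⟩ <;> simp

@[simp]
theorem coronaLift_apply_none (p : (V → ℂ) × (V → ℂ)) (a : V) :
    coronaLift W p ⟨a, none⟩ = p.1 a := rfl

@[simp]
theorem coronaLift_apply_some (p : (V → ℂ) × (V → ℂ)) (a : V) (w : W a) :
    coronaLift W p ⟨a, some w⟩ = p.2 a := rfl

theorem coronaLift_single_zero [DecidableEq V] [∀ v, DecidableEq (W v)] (a : V) :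
    coronaLift W (Pi.single a 1, 0) = Pi.single ⟨a, none⟩ 1 := by
  ext ⟨b, _ | w⟩
  · by_cases h : b = a
    · subst h; simp
    · simp [h]
  · have : (⟨b, some w⟩ : Σ v, Option (W v)) ≠ ⟨a, none⟩ := by
      rintro ⟨⟩
    simp [this]

variable [Fintype V] [DecidableEq V] [∀ v, Fintype (W v)] [∀ v, DecidableEq (W v)] {m : ℕ}

open Classical in
theorem corona_lapMatrix_mulVec_coronaLift (hW : ∀ v, Fintype.card (W v) = m) (g h : V → ℂ) :
    (corona G H).lapMatrix ℂ *ᵥ coronaLift W (g, h) =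
      coronaLift W (G.lapMatrix ℂ *ᵥ g + (m : ℂ) • (g - h), h - g) := by
  ext ⟨a, _ | w⟩ <;>
    rw [lapMatrix_mulVec_eq_sum_ite, Fintype.sum_sigma] <;>
    simp_rw [Fintype.sum_option]
  · simp_rw [corona_adj_none_none, corona_adj_none_some]
    simp [Finset.sum_add_distrib, mul_sub, ← lapMatrix_mulVec_eq_sum_ite, hW]
  · have hsome (b : V) (w' : W b) : (if (corona G H).Adj ⟨a, some w⟩ ⟨b, some w'⟩ then
        coronaLift W (g, h) ⟨a, some w⟩ - coronaLift W (g, h) ⟨b, some w'⟩ else 0) = 0 := by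
      split_ifs with hadj
      · obtain rfl := eq_of_corona_adj_some_some hadj
        simp
      · rfl
    have hnone (b : V) : (corona G H).Adj ⟨a, some w⟩ ⟨b, none⟩ ↔ b = a := by
      rw [SimpleGraph.adj_comm, corona_adj_none_some]
    simp_rw [hsome, hnone]
    simp

open Classical in
theorem corona_lapMatrix_mulVec_coronaLift_of_mulVec_eq (hW : ∀ v, Fintype.card (W v) = m)
    {f : V → ℂ} {μ θ : ℂ} (hf : G.lapMatrix ℂ *ᵥ f = μ • f)
    (hθ : θ ^ 2 - (m + 1 + μ) * θ + μ = 0) :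
    (corona G H).lapMatrix ℂ *ᵥ coronaLift W ((1 - θ) • f, f) =
      θ • coronaLift W ((1 - θ) • f, f) := by
  rw [corona_lapMatrix_mulVec_coronaLift hW, ← map_smul, Matrix.mulVec_smul, hf]
  congr 1
  ext x
  · simp only [Pi.add_apply, Pi.smul_apply, Pi.sub_apply, smul_eq_mul, Prod.smul_fst]
    linear_combination f x * hθ
  · simp only [Pi.smul_apply, Pi.sub_apply, smul_eq_mul, Prod.smul_snd]
    ring

end corona

/-- The distance between the two eigenvalues of the corona that lie over the eigenvalue `μ` of the
base graph, the roots of `θ² - (m + 1 + μ) θ + μ`. -/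
noncomputable def coronaGap (m : ℕ) (μ : ℝ) : ℝ :=
  √((m + 1 + μ) ^ 2 - 4 * μ)

/-- The eigenvalues of the corona that lie over the eigenvalue `μ` of the base graph, indexed by the
sign of the square root in the quadratic formula. -/
noncomputable def coronaEigenvalue (m : ℕ) (μ : ℝ) (σ : ℤˣ) : ℝ :=
  (m + 1 + μ + σ * coronaGap m μ) / 2

theorem coronaGap_sq (m : ℕ) (μ : ℝ) : coronaGap m μ ^ 2 = (m + 1 + μ) ^ 2 - 4 * μ :=
  Real.sq_sqrt (by nlinarith [sq_nonneg (m - 1 + μ), m.cast_nonneg (α := ℝ)])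

theorem coronaGap_pos {m : ℕ} (hm : 1 ≤ m) (μ : ℝ) : 0 < coronaGap m μ :=
  Real.sqrt_pos.2 (by nlinarith [sq_nonneg (m - 1 + μ), show (1 : ℝ) ≤ m from mod_cast hm])

theorem coronaGap_zero (m : ℕ) : coronaGap m 0 = m + 1 := by
  rw [coronaGap, add_zero, mul_zero, sub_zero, Real.sqrt_sq (by positivity)]

theorem irrational_coronaGap {m l : ℕ} (hm : 1 ≤ m) (hl : l ≠ 0) : Irrational (coronaGap m l) := by
  obtain ⟨m, rfl⟩ := Nat.exists_eq_add_of_le' hm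
  have hgap : coronaGap (m + 1) l = √(((m + l) ^ 2 + 4 * (m + 1) : ℕ) : ℝ) := by
    rw [coronaGap]
    push_cast
    ring_nf
  rw [hgap, irrational_sqrt_natCast_iff]
  rintro ⟨s, hs⟩
  have hlower : m + l < s := by nlinarith
  have hupper : s < m + l + 2 := by nlinarith [Nat.pos_of_ne_zero hl]
  obtain rfl : s = m + l + 1 := by omega
  have hparity : 2 * m + 3 = 2 * l := by linarith
  omega

theorem coronaEigenvalue_sq (m : ℕ) (μ : ℝ) (σ : ℤˣ) :
    coronaEigenvalue m μ σ ^ 2 - (m + 1 + μ) * coronaEigenvalue m μ σ + μ = 0 := by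
  have hσ : (σ : ℝ) ^ 2 = 1 := by
    obtain rfl | rfl := Int.units_eq_one_or σ <;> simp
  rw [coronaEigenvalue]
  linear_combination coronaGap m μ ^ 2 / 4 * hσ + coronaGap_sq m μ / 4

theorem sum_smul_coronaLift {V : Type*} (W : V → Type*) {m : ℕ} (hm : 1 ≤ m) (μ : ℝ) (f : V → ℂ) :
    ∑ σ : ℤˣ, (-σ / coronaGap m μ : ℂ) •
      coronaLift W ((1 - coronaEigenvalue m μ σ : ℂ) • f, f) = coronaLift W (f, 0) := by
  have hgap : (coronaGap m μ : ℂ) ≠ 0 := mod_cast (coronaGap_pos hm μ).ne'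
  rw [UnitsInt.univ, Finset.sum_pair (by decide), ← map_smul, ← map_smul, ← map_add]
  congr 1
  ext x
  · simp only [coronaEigenvalue, Prod.smul_mk, Prod.mk_add_mk, Pi.add_apply, Pi.smul_apply,
      smul_eq_mul, Units.val_one, Units.val_neg]
    push_cast
    field_simp
    ring
  · simp only [Prod.smul_mk, Prod.mk_add_mk, Pi.add_apply, Pi.smul_apply, smul_eq_mul,
      Units.val_one, Units.val_neg, Pi.zero_apply]
    push_cast
    ring

open Classical in
theorem corona_hasPrettyGoodStateTransfer_of_sum_eigenvectors {ι V : Type*} [Fintype ι] [Fintype V]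
    [DecidableEq V] {G : SimpleGraph V} {W : V → Type*} [∀ v, Fintype (W v)]
    [∀ v, DecidableEq (W v)] {H : ∀ v, SimpleGraph (W v)} {m : ℕ} (hm : 1 ≤ m)
    (hW : ∀ v, Fintype.card (W v) = m) {u v : V} {p : ι → V → ℂ} {μ : ι → ℝ} {s : ι → ℂ}
    (hp : ∀ i, G.lapMatrix ℂ *ᵥ p i = (μ i : ℂ) • p i) (hu : ∑ i, p i = Pi.single u 1)
    (hv : ∑ i, s i • p i = Pi.single v 1)
    (h : ∀ δ > 0, ∃ t : ℝ, ∀ i σ,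
      ‖Complex.exp (-(Complex.I * t) * coronaEigenvalue m (μ i) σ) - s i‖ < δ) :
    HasPrettyGoodStateTransfer (corona G H) ⟨u, none⟩ ⟨v, none⟩ := by
  let P (i : ι × ℤˣ) : (Σ v, Option (W v)) → ℂ := (-i.2 / coronaGap m (μ i.1) : ℂ) •
    coronaLift W ((1 - coronaEigenvalue m (μ i.1) i.2 : ℂ) • p i.1, p i.1)
  have hP (c : ι → ℂ) {x : V} (hx : ∑ i, c i • p i = Pi.single x 1) :
      ∑ i : ι × ℤˣ, c i.1 • P i = Pi.single ⟨x, none⟩ 1 := by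
    simp_rw [Fintype.sum_prod_type, ← Finset.smul_sum, P, sum_smul_coronaLift W hm, ← map_smul,
      ← map_sum]
    rw [← coronaLift_single_zero, ← hx]
    congr 1
    ext x <;> simp [Prod.fst_sum, Prod.snd_sum]
  refine hasPrettyGoodStateTransfer_of_sum_eigenvectors (p := P)
    (θ := fun i ↦ coronaEigenvalue m (μ i.1) i.2) (s := fun i ↦ s i.1) (fun i ↦ ?_)
    (by simpa using hP 1 (by simpa using hu)) (hP s hv)
    fun δ hδ ↦ (h δ hδ).imp fun t ht i ↦ ht i.1 i.2
  have hroot := congrArg ((↑) : ℝ → ℂ) (coronaEigenvalue_sq m (μ i.1) i.2)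
  push_cast at hroot
  rw [Matrix.mulVec_smul, smul_comm]
  exact congrArg _ (corona_lapMatrix_mulVec_coronaLift_of_mulVec_eq hW (hp i.1) hroot)

theorem IsIntOrSurd.units_mul {y : ℝ} (hy : IsIntOrSurd y) (σ : ℤˣ) : IsIntOrSurd (σ * y) := by
  obtain rfl | rfl := Int.units_eq_one_or σ
  · simpa using hy
  · rcases hy with ⟨a, rfl⟩ | ⟨hirr, d, hd⟩
    · exact .inl ⟨-a, by simp⟩
    · exact .inr ⟨by simpa using hirr, d, by simpa using hd⟩

theorem isIntOrSurd_coronaGap_div {m : ℕ} (hm : 1 ≤ m) (l : ℕ) {d : ℕ} (hd : d ∣ m + 1) :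
    IsIntOrSurd (coronaGap m l / d) := by
  have hd₀ : d ≠ 0 := ne_zero_of_dvd_ne_zero m.succ_ne_zero hd
  obtain rfl | hl := eq_or_ne l 0
  · refine .inl ⟨((m + 1) / d : ℕ), ?_⟩
    rw [Nat.cast_zero, coronaGap_zero, Int.cast_natCast, Nat.cast_div hd (mod_cast hd₀)]
    push_cast
    rfl
  · refine .inr ⟨(irrational_coronaGap hm hl).div_natCast hd₀,
      ((m + 1 + l) ^ 2 - 4 * l) / d ^ 2, ?_⟩
    rw [div_pow, coronaGap_sq]
    push_cast
    rfl

theorem exp_mul_coronaEigenvalue {q : ℤ} (hq : Odd q) {m r c : ℕ} (hc : m + 1 = 2 ^ (r + 1) * c)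
    (k : ℕ) (σ : ℤˣ) :
    Complex.exp (-(Complex.I * (-(2 * Real.pi * q / 2 ^ r) : ℝ)) *
        coronaEigenvalue m (2 ^ r * k) σ) =
      (-1) ^ k * Complex.exp (2 * Real.pi * Complex.I *
        (q * (σ * (coronaGap m (2 ^ r * k) / 2 ^ (r + 1)) : ℝ))) := by
  have hsign : Complex.exp ((q * (2 * c + k) : ℤ) * (Real.pi * Complex.I)) = (-1) ^ k := by
    rw [Complex.exp_int_mul, Complex.exp_pi_mul_I, zpow_mul, hq.neg_one_zpow]
    rw [zpow_add₀ (by norm_num), (even_two_mul _).neg_one_zpow, one_mul, zpow_natCast]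
  have hc' : (m + 1 : ℂ) = 2 ^ (r + 1) * c := mod_cast hc
  rw [← hsign, ← Complex.exp_add, coronaEigenvalue]
  congr 1
  push_cast
  rw [hc']
  field_simp
  ring

theorem exists_norm_exp_mul_coronaEigenvalue_sub_lt {ι : Type*} [Finite ι] {m r : ℕ} (hm : 1 ≤ m)
    (hdvd : 2 ^ (r + 1) ∣ m + 1) (k : ι → ℕ) {δ : ℝ} (hδ : 0 < δ) :
    ∃ t : ℝ, ∀ i (σ : ℤˣ),
      ‖Complex.exp (-(Complex.I * t) * coronaEigenvalue m (2 ^ r * k i) σ) - (-1) ^ k i‖ < δ := by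
  have hy (i : ι × ℤˣ) :
      IsIntOrSurd (i.2 * (coronaGap m (2 ^ r * k i.1) / 2 ^ (r + 1))) := by
    simpa using (isIntOrSurd_coronaGap_div hm (2 ^ r * k i.1) hdvd).units_mul i.2
  obtain ⟨q, hq, hqδ⟩ := exists_odd_norm_exp_sub_one_lt hy hδ
  obtain ⟨c, hc⟩ := hdvd
  refine ⟨-(2 * Real.pi * q / 2 ^ r), fun i σ ↦ ?_⟩
  rw [exp_mul_coronaEigenvalue hq hc, ← mul_sub_one, norm_mul, norm_pow, norm_neg, norm_one,
    one_pow, one_mul]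
  exact hqδ (i, σ)

end LaplacianWalk

theorem mainTheorem2 {V : Type*} [Fintype V] [DecidableEq V] (G : SimpleGraph V)
    {W : V → Type*} [∀ v, Fintype (W v)] [∀ v, DecidableEq (W v)]
    (H : ∀ v, SimpleGraph (W v)) (m : ℕ) (hm : 1 ≤ m) (hW : ∀ v, Fintype.card (W v) = m)
    (u v : V) (hG : LaplacianWalk.HasPerfectStateTransfer G u v)
    (r : ℕ)
    (hr : LaplacianWalk.IsGreatestTwoPowDvd (LaplacianWalk.eigenvalueSupport G u) r)
    (hdvd : 2 ^ (r + 1) ∣ m + 1) :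
    LaplacianWalk.HasPrettyGoodStateTransfer (LaplacianWalk.corona G H)
      ⟨u, none⟩ ⟨v, none⟩ := by
  classical
  obtain rfl | huv := eq_or_ne u v
  · exact LaplacianWalk.hasPrettyGoodStateTransfer_refl _ _
  obtain ⟨p, k, hp, hu, hv⟩ := hG.exists_sum_eigenvectors huv hr
  exact LaplacianWalk.corona_hasPrettyGoodStateTransfer_of_sum_eigenvectors
    (μ := fun j ↦ 2 ^ r * k j) hm hW (fun j ↦ by simpa using hp j) hu hv
    fun δ hδ ↦ LaplacianWalk.exists_norm_exp_mul_coronaEigenvalue_sub_lt hm hdvd k hδ
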